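/- **Model.** A network is a finite connected graph; nodes are anonymous, and at each node the incident links carry pairwise distinct local labels (arbitrary otherwise). Every node has a whiteboard, which can store control information as well as gossip information (*full whiteboard*). Agents are anonymous: all of them run the same deterministic state machine, with an arbitrary set of states, which depends neither on the network nor on the number of agents. An agent that acts at a node sees its own state, the states of the other agents at the node, the local link labels, the label of the link through which it came (if any), and the whiteboard; it then changes its state, rewrites the whiteboard, and stays or leaves through an incident link. Each agent has a piece of gossip information, which the machine treats as opaque data: it can be copied into the memory of an agent from the whiteboard of its node or from other agents at the node, and from there onto the whiteboard, and it can be erased, but it cannot be inspected or made up. The model is asynchronous: actions at a node, and arrivals at a node, occur one at a time in an arbitrary order, an agent that has left a node may stay on the link for an arbitrary finite time, and every agent is scheduled infinitely often. Links are either all *full-duplex* (agents may pass each other on a link in opposite directions) or all *half-duplex* (a link is never used in both directions at the same time). An execution may start in any configuration (locations, states, memories and whiteboard contents are arbitrary). **Problem.** An algorithm is a *self-stabilizing solution* of the gossip problem if, for every number of agents and every network, in every execution every agent knows, from some point on, the gossip information of all agents. It is *$l$-quiescent* for $k$ agents if every execution with $k$ agents reaches a configuration after which at least $l$ agents remain still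 forever. The *quiescence number* of the $k$-gossip problem is the maximum integer $l\ge 0$ for which there is a self-stabilizing solution that is $l$-quiescent for $k$ agents, and $-1$ if there is no self-stabilizing solution. **Theorem.** Let $k\ge 2$. In the asynchronous model with full whiteboards, for full-duplex as well as for half-duplex links, the quiescence number of the $k$-gossip problem among anonymous agents is $0$. -/

import Mathlib

namespace MobileAgents

/-- Link capacity: half-duplex links carry agents in at most one direction at a time. -/
inductive Duplex where
  | half
  | full

/-- A finite connected network. The links at a node `v` carry pairwise distinct local labels:
`port v w` is the label at `v` of the link towards its neighbour `w`. Nothing else is assumed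
about the labels. -/
structure Network where
  V : Type
  finite : Finite V
  graph : SimpleGraph V
  connected : graph.Connected
  port : V → V → ℕ
  port_inj : ∀ v w w', graph.Adj v w → graph.Adj v w' → port v w = port v w' → w = w'

/-- The possible origins of gossip information that an agent can copy while acting at a node:
its own collection, the whiteboard of the node, the collections of the other agents that are
at the node and are in state `s`. -/
inductive Source (S : Type) where
  | own
  | board
  | peer (s : S)

/-- What an acting agent observes: its state, the states of the other agents at the node, the
local link labels, the label of the link through which it came (if any), and the whiteboard. -/
structure View (S B : Type) where
  state : S
  others : Multiset S
  ports : Set ℕ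
  inPort : Option ℕ
  board : B

/-- What an acting agent does: it changes its state, rewrites the whiteboard, leaves through the
link with label `move` (it stays if `move` is `none` or is not a label of the node), and
replaces the gossip information in its memory, resp. on the whiteboard, by the union of the
collections named in `remember`, resp. `publish`. -/
structure Action (S B : Type) where
  state : S
  board : B
  move : Option ℕ
  remember : Set (Source S)
  publish : Set (Source S)

/-- A distributed algorithm for anonymous agents: one deterministic state machine, run by every
agent. It knows neither the network, nor the number of agents, nor any identifier; gossip
information is opaque data, which can be copied and erased but not produced or inspected. -/
structure Algorithm where
  State : Type
  Board : Type
  state_nonempty : Nonempty State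
  board_nonempty : Nonempty Board
  act : View State Board → Action State Board

/-- An agent is at a node (with the neighbour from which it came there, if any), or is moving
along a link in a given direction. -/
inductive Location (N : Network) where
  | node (v : N.V) (came : Option (N.graph.neighborSet v))
  | link (e : N.graph.Dart)

/-- A configuration of `k` agents: their locations, states and memories of collected gossip
information, and, for each node, the whiteboard with its control and its gossip part. -/
structure Config (A : Algorithm) (N : Network) (I : Type) (k : ℕ) where
  loc : Fin k → Location N
  state : Fin k → A.State
  mem : Fin k → Set I
  board : N.V → A.Board
  boardMem : N.V → Set I

namespace Location

def IsAt {N : Network} (v : N.V) : Location N → Prop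
  | node u _ => u = v
  | link _ => False

open Classical in
/-- The location of an agent at `v` after it has decided to stay (`none`) or to leave through
the link labelled `p` (`some p`). -/
noncomputable def depart {N : Network} (v : N.V) (came : Option (N.graph.neighborSet v)) :
    Option ℕ → Location N
  | none => node v came
  | some p =>
    if h : ∃ w, N.graph.Adj v w ∧ N.port v w = p then
      link ⟨(v, h.choose), h.choose_spec.1⟩
    else node v came

end Location

namespace Config

variable {A : Algorithm} {N : Network} {I : Type} {k : ℕ}

/-- The gossip information known to agent `i`: its own, and everything in its memory. -/
def known (info : Fin k → I) (c : Config A N I k) (i : Fin k) : Set I :=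
  insert (info i) (c.mem i)

open Classical in
noncomputable def view (c : Config A N I k) (i : Fin k) (v : N.V)
    (came : Option (N.graph.neighborSet v)) : View A.State A.Board where
  state := c.state i
  others := (Finset.univ.filter fun j => j ≠ i ∧ (c.loc j).IsAt v).val.map c.state
  ports := {p | ∃ w, N.graph.Adj v w ∧ N.port v w = p}
  inPort := came.map fun w => N.port v w
  board := c.board v

/-- The union of the collections named by `R`, for agent `i` acting at node `v`. -/
def gather (info : Fin k → I) (c : Config A N I k) (i : Fin k) (v : N.V)
    (R : Set (Source A.State)) : Set I :=
  {x | (Source.own ∈ R ∧ x ∈ c.known info i) ∨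
    (Source.board ∈ R ∧ x ∈ c.boardMem v) ∨
    ∃ j, j ≠ i ∧ (c.loc j).IsAt v ∧ Source.peer (c.state j) ∈ R ∧ x ∈ c.known info j}

open Classical in
/-- The configuration after agent `i` has been scheduled: an agent on a link arrives at the end
of the link; an agent at a node executes its action there. -/
noncomputable def next (info : Fin k → I) (c : Config A N I k) (i : Fin k) : Config A N I k :=
  match c.loc i with
  | Location.link e =>
    { c with
      loc := Function.update c.loc i (Location.node e.snd (some ⟨e.fst, e.adj.symm⟩)) }
  | Location.node v came =>
    let a := A.act (c.view i v came)
    { loc := Function.update c.loc i (Location.depart v came a.move)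
      state := Function.update c.state i a.state
      mem := Function.update c.mem i (c.gather info i v a.remember)
      board := Function.update c.board v a.board
      boardMem := Function.update c.boardMem v (c.gather info i v a.publish) }

/-- Half-duplex links are never used in both directions at the same time. -/
def Legal (c : Config A N I k) : Duplex → Prop
  | Duplex.full => True
  | Duplex.half => ∀ i j e, c.loc i = Location.link e → c.loc j ≠ Location.link e.symm

end Config

/-- An asynchronous execution, started in an arbitrary configuration: agents act one after the
other, in an arbitrary order in which every agent is scheduled again and again. -/
structure Execution (d : Duplex) (A : Algorithm) (N : Network) {I : Type} {k : ℕ}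
    (info : Fin k → I) where
  conf : ℕ → Config A N I k
  sched : ℕ → Fin k
  legal : ∀ t, (conf t).Legal d
  step : ∀ t, conf (t + 1) = (conf t).next info (sched t)
  fair : ∀ i t, ∃ t', t ≤ t' ∧ sched t' = i

/-- `A` is a self-stabilizing solution of the gossip problem: whatever the number `k` of agents
and the network, in every execution, every agent knows the gossip information of all agents
from some point on. -/
def IsGossipSolution (d : Duplex) (A : Algorithm) : Prop :=
  ∀ (k : ℕ) (N : Network) (I : Type) (info : Fin k → I) (E : Execution d A N info),
    ∃ T, ∀ t, T ≤ t → ∀ i j, info j ∈ (E.conf t).known info i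

/-- Every execution of `A` with `k` agents reaches a configuration after which at least `l`
agents remain still forever. -/
def IsQuiescent (d : Duplex) (A : Algorithm) (k l : ℕ) : Prop :=
  ∀ (N : Network) (I : Type) (info : Fin k → I) (E : Execution d A N info),
    ∃ (T : ℕ) (Q : Finset (Fin k)), l ≤ Q.card ∧
      ∀ i ∈ Q, ∀ t, T ≤ t → (E.conf t).loc i = (E.conf T).loc i

/-- `q` is the quiescence number of the `k`-gossip problem among anonymous agents, in the
asynchronous model with full whiteboards and links of capacity `d`: the maximum `l` for which an
`l`-quiescent self-stabilizing solution exists, and `-1` if there is none for any `l`. -/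
def IsQuiescenceNumber (d : Duplex) (k : ℕ) (q : ℤ) : Prop :=
  IsGreatest (insert (-1)
    {l : ℤ | ∃ n : ℕ, l = n ∧ ∃ A : Algorithm, IsGossipSolution d A ∧ IsQuiescent d A k n}) q

end MobileAgents

/-! The value 0 is attained by `explorer`. The counters on the whiteboards make every label of a
node visited infinitely often recur as an exit. By finiteness some node is visited infinitely often,
hence by connectedness all are, and information spreads from whiteboard to whiteboard
(`Explorer.exists_known`).

Conversely, let `A` be any solution, run on two nodes joined by one link. Suppose that a crowd of
agents at a node would never lose a member, in whatever order its members act. Put a copy of the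
crowd at each node. An agent sees only its own node, and the algorithm does not depend on the number
of agents, so both copies stay put and no information crosses: `A` fails for twice as many agents
(`IsGossipSolution.exists_leaves`). Hence some order of actions makes some agent leave. That agent
is held on the link and the argument is repeated with the smaller crowd, until a prescribed agent
has left (`Config.exists_run_leave_of_outward`). All held agents travel in the same direction, so
half-duplex links allow this too. Letting everyone arrive and treating the agents in turn, forever,
gives a fair execution in which no agent comes to rest (`exists_execution_moving`). -/

namespace MobileAgents

open Function Set

/-! ### The effect of a single step -/

namespace Config

variable {A : Algorithm} {N : Network} {I : Type} {k : ℕ} {info : Fin k → I}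
  {c : Config A N I k} {i j : Fin k}

theorem next_of_link {e : N.graph.Dart} (h : c.loc i = .link e) :
    c.next info i =
      { c with loc := update c.loc i (.node e.snd (some ⟨e.fst, e.adj.symm⟩)) } := by
  unfold Config.next
  split
  · rename_i e' h'
    rw [h] at h'
    cases h'
    rfl
  · simp_all

open Classical in
theorem next_of_node {v : N.V} {came : Option (N.graph.neighborSet v)}
    (h : c.loc i = .node v came) :
    c.next info i =
      { loc := update c.loc i (.depart v came (A.act (c.view i v came)).move)
        state := update c.state i (A.act (c.view i v came)).state
        mem := update c.mem i (c.gather info i v (A.act (c.view i v came)).remember)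
        board := update c.board v (A.act (c.view i v came)).board
        boardMem :=
          update c.boardMem v (c.gather info i v (A.act (c.view i v came)).publish) } := by
  unfold Config.next
  split
  · simp_all
  · rename_i v' came' h'
    rw [h] at h'
    cases h'
    rfl

theorem next_loc_of_ne (h : i ≠ j) : (c.next info j).loc i = c.loc i := by
  rcases hj : c.loc j with ⟨v, came⟩ | e
  · simp [next_of_node hj, h]
  · simp [next_of_link hj, h]

theorem next_mem_of_ne (h : i ≠ j) : (c.next info j).mem i = c.mem i := by
  rcases hj : c.loc j with ⟨v, came⟩ | e
  · simp [next_of_node hj, h]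
  · simp [next_of_link hj]

end Config

theorem Location.depart_port {N : Network} {v w : N.V} (came : Option (N.graph.neighborSet v))
    (h : N.graph.Adj v w) :
    Location.depart v came (some (N.port v w)) = .link ⟨(v, w), h⟩ := by
  have hex : ∃ u, N.graph.Adj v u ∧ N.port v u = N.port v w := ⟨w, h, rfl⟩
  have hw : hex.choose = w := N.port_inj v _ _ hex.choose_spec.1 h hex.choose_spec.2
  simp only [Location.depart, dif_pos hex]
  congr 3

/-! ### Fairness: every agent acts at nodes again and again -/

namespace Execution

variable {d : Duplex} {A : Algorithm} {N : Network} {I : Type} {k : ℕ} {info : Fin k → I}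

theorem loc_eq_of_not_scheduled (E : Execution d A N info) {i : Fin k} {T t : ℕ} (hT : T ≤ t)
    (h : ∀ s, T ≤ s → s < t → E.sched s ≠ i) : (E.conf t).loc i = (E.conf T).loc i := by
  induction t, hT using Nat.le_induction with
  | base => rfl
  | succ t ht ih =>
    rw [E.step, Config.next_loc_of_ne (h t ht (Nat.lt_succ_self t)).symm]
    exact ih fun s h1 h2 => h s h1 (h2.trans (Nat.lt_succ_self t))

/-- The next time an agent is scheduled, it is still where it was. -/
theorem exists_sched_loc_eq (E : Execution d A N info) (i : Fin k) (T : ℕ) :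
    ∃ t, T ≤ t ∧ E.sched t = i ∧ (E.conf t).loc i = (E.conf T).loc i := by
  classical
  have h := E.fair i T
  refine ⟨Nat.find h, (Nat.find_spec h).1, (Nat.find_spec h).2,
    E.loc_eq_of_not_scheduled (Nat.find_spec h).1 fun s h1 h2 h3 => ?_⟩
  exact Nat.find_min h h2 ⟨h1, h3⟩

/-- Agent `i` acts at node `v` at time `t`. -/
def ActsAt (E : Execution d A N info) (t : ℕ) (i : Fin k) (v : N.V) : Prop :=
  E.sched t = i ∧ ∃ came, (E.conf t).loc i = .node v came

theorem exists_actsAt_of_node (E : Execution d A N info) {i : Fin k} {T : ℕ} {v : N.V}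
    {came : Option (N.graph.neighborSet v)} (h : (E.conf T).loc i = .node v came) :
    ∃ t, T ≤ t ∧ E.ActsAt t i v := by
  obtain ⟨t, ht, hs, hl⟩ := E.exists_sched_loc_eq i T
  exact ⟨t, ht, hs, came, hl.trans h⟩

theorem exists_actsAt_of_link (E : Execution d A N info) {i : Fin k} {T : ℕ}
    {e : N.graph.Dart} (h : (E.conf T).loc i = .link e) :
    ∃ t, T ≤ t ∧ E.ActsAt t i e.snd := by
  obtain ⟨t, ht, hs, hl⟩ := E.exists_sched_loc_eq i T
  have hn : (E.conf (t + 1)).loc i = .node e.snd (some ⟨e.fst, e.adj.symm⟩) := by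
    rw [E.step, hs, Config.next_of_link (hl.trans h)]
    simp
  obtain ⟨t', ht', h'⟩ := E.exists_actsAt_of_node hn
  exact ⟨t', by omega, h'⟩

theorem exists_actsAt (E : Execution d A N info) (i : Fin k) (T : ℕ) :
    ∃ t v, T ≤ t ∧ E.ActsAt t i v := by
  rcases h : (E.conf T).loc i with ⟨v, came⟩ | e
  · obtain ⟨t, ht⟩ := E.exists_actsAt_of_node h
    exact ⟨t, v, ht⟩
  · obtain ⟨t, ht⟩ := E.exists_actsAt_of_link h
    exact ⟨t, _, ht⟩

end Execution

/-! ### A self-stabilizing solution -/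

/-- Every agent spreads all the information it sees. The whiteboard of a node counts the actions
at the node; the agents leave it through the labels `(Nat.unpair n).1`, `n = 0, 1, 2, …`, among
which every label of the node occurs again and again. -/
def explorer : Algorithm where
  State := Unit
  Board := ℕ
  state_nonempty := ⟨()⟩
  board_nonempty := ⟨0⟩
  act V := ⟨(), V.board + 1, some (Nat.unpair V.board).1, univ, univ⟩

namespace Explorer

variable {d : Duplex} {N : Network} {I : Type} {k : ℕ} {info : Fin k → I}
  (E : Execution d explorer N info)

/-- The number on the whiteboard of `v`. -/
def count (c : Config explorer N I k) (v : N.V) : ℕ := c.board v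

theorem count_actsAt {t : ℕ} {i : Fin k} {v : N.V} (h : E.ActsAt t i v) :
    count (E.conf (t + 1)) v = count (E.conf t) v + 1 := by
  obtain ⟨hs, came, hl⟩ := h
  rw [E.step, hs, Config.next_of_node hl]
  simp [count, explorer, Config.view]

theorem count_not_actsAt {t : ℕ} {v : N.V} (h : ∀ i, ¬ E.ActsAt t i v) :
    count (E.conf (t + 1)) v = count (E.conf t) v := by
  rw [E.step]
  rcases hl : (E.conf t).loc (E.sched t) with ⟨u, came⟩ | e
  · have hu : v ≠ u := fun huv => h _ ⟨rfl, by subst huv; exact ⟨came, hl⟩⟩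
    rw [Config.next_of_node hl]
    classical exact update_of_ne hu _ _
  · rw [Config.next_of_link hl]
    rfl

theorem loc_actsAt {t : ℕ} {i : Fin k} {v w : N.V} (h : E.ActsAt t i v)
    (hw : N.graph.Adj v w) (hb : (Nat.unpair (count (E.conf t) v)).1 = N.port v w) :
    (E.conf (t + 1)).loc i = .link ⟨(v, w), hw⟩ := by
  obtain ⟨hs, came, hl⟩ := h
  rw [E.step, hs, Config.next_of_node hl]
  simp only [update_self]
  rw [← Location.depart_port came hw, ← hb]
  rfl

theorem known_actsAt {t : ℕ} {i : Fin k} {v : N.V} (h : E.ActsAt t i v) :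
    (E.conf t).boardMem v ⊆ (E.conf (t + 1)).known info i := by
  obtain ⟨hs, came, hl⟩ := h
  intro x hx
  rw [E.step, hs, Config.next_of_node hl]
  right
  simp only [update_self]
  exact Or.inr (Or.inl ⟨mem_univ _, hx⟩)

theorem boardMem_actsAt {t : ℕ} {i : Fin k} {v : N.V} (h : E.ActsAt t i v) :
    (E.conf t).known info i ⊆ (E.conf (t + 1)).boardMem v := by
  obtain ⟨hs, came, hl⟩ := h
  intro x hx
  rw [E.step, hs, Config.next_of_node hl]
  simp only [update_self]
  exact Or.inl ⟨mem_univ _, hx⟩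

theorem known_mono (i : Fin k) : Monotone fun t => (E.conf t).known info i := by
  refine monotone_nat_of_le_succ fun t x hx => ?_
  rw [E.step]
  rcases eq_or_ne i (E.sched t) with h | h
  · rcases hl : (E.conf t).loc (E.sched t) with ⟨u, came⟩ | e
    · rw [Config.next_of_node hl, ← h]
      right
      simp only [update_self]
      exact Or.inl ⟨mem_univ _, hx⟩
    · rw [Config.next_of_link hl]
      exact hx
  · rw [Config.known, Config.next_mem_of_ne h]
    exact hx

theorem boardMem_mono (v : N.V) : Monotone fun t => (E.conf t).boardMem v := by
  refine monotone_nat_of_le_succ fun t x hx => ?_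
  rw [E.step]
  rcases hl : (E.conf t).loc (E.sched t) with ⟨u, came⟩ | e
  · rw [Config.next_of_node hl]
    rcases eq_or_ne v u with rfl | h
    · simp only [update_self]
      exact Or.inr (Or.inl ⟨mem_univ _, hx⟩)
    · simpa [h] using hx
  · rw [Config.next_of_link hl]
    exact hx

/-- Agents act at `v` again and again. -/
def Recurrent (v : N.V) : Prop := ∀ T, ∃ t i, T ≤ t ∧ E.ActsAt t i v

/-- Only actions at `v` change its counter, so the first action there from time `T` on still finds
the old value. -/
theorem exists_actsAt_count_eq {v : N.V} (h : Recurrent E v) (T : ℕ) :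
    ∃ t i, T ≤ t ∧ E.ActsAt t i v ∧ count (E.conf t) v = count (E.conf T) v := by
  classical
  have h' : ∃ t, T ≤ t ∧ ∃ i, E.ActsAt t i v := by
    obtain ⟨t, i, ht, hi⟩ := h T
    exact ⟨t, ht, i, hi⟩
  obtain ⟨ht, i, hi⟩ := Nat.find_spec h'
  refine ⟨Nat.find h', i, ht, hi, ?_⟩
  have key : ∀ t, T ≤ t → t ≤ Nat.find h' → count (E.conf t) v = count (E.conf T) v := by
    intro t hTt
    induction t, hTt using Nat.le_induction with
    | base => exact fun _ => rfl
    | succ t hTt ih =>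
      intro hlt
      rw [count_not_actsAt E fun j hj => Nat.find_min h' (by omega : t < _) ⟨hTt, j, hj⟩]
      exact ih (by omega)
  exact key _ ht le_rfl

/-- The counter grows by exactly one per action, so no value is skipped. -/
theorem exists_actsAt_count {v : N.V} (h : Recurrent E v) (T n : ℕ)
    (hn : count (E.conf T) v ≤ n) :
    ∃ t i, T ≤ t ∧ E.ActsAt t i v ∧ count (E.conf t) v = n := by
  induction n, hn using Nat.le_induction with
  | base => exact exists_actsAt_count_eq E h T
  | succ n _ ih =>
    obtain ⟨t, i, ht, hi, hb⟩ := ih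
    obtain ⟨t', i', ht', hi', hb'⟩ := exists_actsAt_count_eq E h (t + 1)
    refine ⟨t', i', by omega, hi', ?_⟩
    rw [hb', count_actsAt E hi, hb]

/-- From a recurrent node, agents leave again and again through each of its links. -/
theorem exists_leaves {v w : N.V} (h : Recurrent E v) (hw : N.graph.Adj v w) (T : ℕ) :
    ∃ t i, T ≤ t ∧ E.ActsAt t i v ∧ ∃ t', t + 1 ≤ t' ∧ E.ActsAt t' i w := by
  -- This counter value decodes to the label of the link, and pairing with the current count ensures
  -- that it is still to come.
  obtain ⟨t, i, ht, hi, hb⟩ := exists_actsAt_count E h T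
    (Nat.pair (N.port v w) (count (E.conf T) v)) (Nat.right_le_pair _ _)
  have hl := loc_actsAt E hi hw (by rw [hb, Nat.unpair_pair])
  exact ⟨t, i, ht, hi, E.exists_actsAt_of_link hl⟩

theorem Network.induction_on_links {P : N.V → Prop} {u : N.V} (hu : P u)
    (h : ∀ v w, P v → N.graph.Adj v w → P w) (v : N.V) : P v := by
  obtain ⟨p⟩ := N.connected.preconnected u v
  induction p with
  | nil => exact hu
  | cons hadj _ ih => exact ih (h _ _ hu hadj)

/-- Agent `i` acts infinitely often and there are finitely many nodes, so some node is recurrent;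
recurrence then spreads along links. -/
theorem recurrent (i : Fin k) (v : N.V) : Recurrent E v := by
  have := N.finite
  have hex : ∃ u, Recurrent E u := by
    by_contra hcon
    simp only [Recurrent, not_exists, not_forall] at hcon
    choose T hT using hcon
    obtain ⟨M, hM⟩ := (Set.finite_range T).bddAbove
    obtain ⟨t, u, ht, hu⟩ := E.exists_actsAt i M
    exact hT u t i ⟨(hM (mem_range_self u)).trans ht, hu⟩
  obtain ⟨u, hu⟩ := hex
  refine Network.induction_on_links hu (fun v w hv hw T => ?_) v
  obtain ⟨t, i, ht, _, t', ht', hi'⟩ := exists_leaves E hv hw T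
  exact ⟨t', i, by omega, hi'⟩

/-- Once the information is on the whiteboard of `v`, any later agent leaving for a neighbour
carries it there and publishes it. -/
theorem exists_mem_boardMem (j : Fin k) (v : N.V) : ∃ t, info j ∈ (E.conf t).boardMem v := by
  obtain ⟨t, u, -, hu⟩ := E.exists_actsAt j 0
  refine Network.induction_on_links (P := fun v => ∃ t, info j ∈ (E.conf t).boardMem v)
    ⟨t + 1, boardMem_actsAt E hu (Or.inl rfl)⟩ (fun v w ⟨T, hT⟩ hw => ?_) v
  obtain ⟨t, i, ht, hi, t', ht', hi'⟩ := exists_leaves E (recurrent E j v) hw T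
  exact ⟨t' + 1, boardMem_actsAt E hi' (known_mono E i ht'
    (known_actsAt E hi (boardMem_mono E v ht hT)))⟩

theorem exists_known (i j : Fin k) : ∃ t, info j ∈ (E.conf t).known info i := by
  have := N.finite
  choose T hT using exists_mem_boardMem E j
  obtain ⟨M, hM⟩ := (Set.finite_range T).bddAbove
  obtain ⟨t, u, ht, hu⟩ := E.exists_actsAt i M
  exact ⟨t + 1, known_actsAt E hu
    (boardMem_mono E u ((hM (mem_range_self u)).trans ht) (hT u))⟩

end Explorer

theorem explorer_isGossipSolution (d : Duplex) : IsGossipSolution d explorer := by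
  intro k N I info E
  choose T hT using fun p : Fin k × Fin k => Explorer.exists_known E p.1 p.2
  obtain ⟨M, hM⟩ := (Set.finite_range T).bddAbove
  exact ⟨M, fun t ht i j => Explorer.known_mono E i
    ((hM (mem_range_self (i, j))).trans ht) (hT (i, j))⟩

/-! ### No agent can be trusted to stop -/

/-- Two nodes joined by a link, which has the same label at both ends. -/
def twoNodes : Network where
  V := Bool
  finite := inferInstance
  graph := ⊤
  connected := SimpleGraph.connected_top
  port _ _ := 0
  port_inj v w w' h h' _ := by
    rw [SimpleGraph.top_adj] at h h'
    cases v <;> cases w <;> cases w' <;> simp_all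

theorem twoNodes_depart_of_ne {v : twoNodes.V} (came : Option (twoNodes.graph.neighborSet v))
    {m : Option ℕ} (h : m ≠ some 0) : Location.depart v came m = .node v came := by
  rcases m with _ | p
  · rfl
  · rw [Location.depart, dif_neg]
    rintro ⟨w, -, hp⟩
    exact h (congrArg some hp.symm)

theorem twoNodes_adj (v : Bool) : twoNodes.graph.Adj v (!v) := by
  exact (SimpleGraph.top_adj v (!v)).2 (by cases v <;> decide)

theorem twoNodes_depart_zero {v : twoNodes.V} (came : Option (twoNodes.graph.neighborSet v)) :
    ∃ e, Location.depart v came (some 0) = .link e ∧ e.fst = v :=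
  ⟨_, Location.depart_port came (twoNodes_adj v), rfl⟩

/-- The situation at a node of `twoNodes`: the states of the agents there (indexed by `α`) and
the whiteboard. -/
structure Crowd (A : Algorithm) (α : Type) where
  state : α → A.State
  board : A.Board

/-! ### A crowd evolves independently of the rest of the network -/

namespace Crowd

variable {A : Algorithm} {α : Type} [Fintype α] (came : α → Bool) (L : Crowd A α) (a : α)

open Classical in
/-- What agent `a` observes; `came` tells which agents came through the link. -/
noncomputable def view : View A.State A.Board where
  state := L.state a
  others := (Finset.univ.filter (· ≠ a)).val.map L.state
  ports := {0}
  inPort := if came a then some 0 else none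
  board := L.board

def Leaves : Prop := (A.act (L.view came a)).move = some 0

open Classical in
/-- The situation after agent `a` has acted and stayed. -/
noncomputable def next : Crowd A α where
  state := update L.state a (A.act (L.view came a)).state
  board := (A.act (L.view came a)).board

variable {I : Type} {k : ℕ}

/-- The agents at node `v` are those in the range of `f`, and their situation is `L`. -/
structure Matches (c : Config A twoNodes I k) (f : α ↪ Fin k) (v : twoNodes.V) : Prop where
  loc : ∀ a, ∃ w, c.loc (f a) = .node v w ∧ w.isSome = came a
  mem_range : ∀ j, (c.loc j).IsAt v → j ∈ range f
  state : ∀ a, c.state (f a) = L.state a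
  board : c.board v = L.board

variable {came L} {c : Config A twoNodes I k} {f : α ↪ Fin k} {v : twoNodes.V}
  {info : Fin k → I}

/-- Neither the node nor the total number of agents enters the view. With a single link, labelled 0
at both ends, the bit `came a` determines the arrival label. -/
theorem Matches.view_eq (h : L.Matches came c f v)
    {w : Option (twoNodes.graph.neighborSet v)} (hw : c.loc (f a) = .node v w) :
    c.view (f a) v w = L.view came a := by
  classical
  have hf : (Finset.univ.filter fun j => j ≠ f a ∧ (c.loc j).IsAt v) =
      (Finset.univ.filter (· ≠ a)).map f := by
    ext j
    simp only [Finset.mem_filter, Finset.mem_univ, true_and, Finset.mem_map]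
    constructor
    · rintro ⟨hj, hv⟩
      obtain ⟨b, rfl⟩ := h.mem_range j hv
      exact ⟨b, fun hb => hj (by rw [hb]), rfl⟩
    · rintro ⟨b, hb, rfl⟩
      obtain ⟨u, hu, -⟩ := h.loc b
      exact ⟨fun hfb => hb (f.injective hfb), by rw [hu]; rfl⟩
  have hs : c.state ∘ f = L.state := funext h.state
  obtain ⟨w', hw', hc⟩ := h.loc a
  rw [hw] at hw'
  cases hw'
  simp only [Config.view, Crowd.view, View.mk.injEq]
  refine ⟨h.state a, ?_, ?_, ?_, h.board⟩
  · rw [← hs, ← Multiset.map_map, ← Finset.map_val]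
    convert rfl using 4
    convert hf.symm
  · ext p
    simp only [mem_ofPred_eq, mem_singleton_iff]
    exact ⟨fun ⟨_, _, hp⟩ => hp.symm, fun hp => ⟨!v, twoNodes_adj v, hp.symm⟩⟩
  · rw [← hc]
    cases w <;> rfl

theorem Matches.exists_next_eq (h : L.Matches came c f v) (ha : ¬ L.Leaves came a) :
    ∃ w, c.loc (f a) = .node v w ∧ w.isSome = came a ∧
      (c.next info (f a)).loc = c.loc ∧
      (c.next info (f a)).state = update c.state (f a) (A.act (L.view came a)).state ∧
      (∀ u, u ≠ v → (c.next info (f a)).board u = c.board u) ∧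
      (c.next info (f a)).board v = (A.act (L.view came a)).board := by
  obtain ⟨w, hw, hc⟩ := h.loc a
  have hv := h.view_eq a hw
  classical
  refine ⟨w, hw, hc, ?_⟩
  rw [Config.next_of_node hw, hv, twoNodes_depart_of_ne w ha]
  refine ⟨?_, rfl, fun u hu => update_of_ne hu _ _, by simp⟩
  rw [← hw]
  exact update_eq_self _ _

theorem Matches.next (h : L.Matches came c f v) (ha : ¬ L.Leaves came a) :
    (L.next came a).Matches came (c.next info (f a)) f v := by
  classical
  obtain ⟨w, hw, hc, hl, hs, -, hb⟩ := h.exists_next_eq (info := info) a ha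
  refine ⟨fun b => ?_, fun j => ?_, fun b => ?_, hb⟩
  · rw [hl]; exact h.loc b
  · rw [hl]; exact h.mem_range j
  · rw [hs, Crowd.next]
    rcases eq_or_ne b a with rfl | hba
    · simp
    · rw [update_of_ne (f.injective.ne hba), h.state]
      exact (update_of_ne hba _ _).symm

theorem Matches.leave (h : L.Matches came c f v) (ha : L.Leaves came a) :
    ∃ e, e.fst = v ∧ (c.next info (f a)).loc = update c.loc (f a) (.link e) := by
  obtain ⟨w, hw, hc⟩ := h.loc a
  obtain ⟨e, he, hv⟩ := twoNodes_depart_zero w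
  refine ⟨e, hv, ?_⟩
  rw [Config.next_of_node hw, h.view_eq a hw, ← he, ← ha]

end Crowd

/-! #### Two crowds that stay apart -/

section Trap

variable {A : Algorithm} {α : Type} {came : α → Bool} {S : Set (Crowd A α)}

/-- A copy of a crowd from `S` at each of the two nodes; no information has passed. -/
structure Apart [Fintype α] {k : ℕ} (came : α → Bool) (S : Set (Crowd A α)) (f : Bool → α ↪ Fin k)
    (c : Config A twoNodes (Fin k) k) : Prop where
  crowd : ∀ v, ∃ L ∈ S, L.Matches came c (f v) v
  mem : ∀ v a, c.mem (f v a) ⊆ range (f v)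
  boardMem : ∀ v, c.boardMem v ⊆ range (f v)

/-- Each agent's gossip is its own index (`info` is `id`), so separation of information reads as
inclusion in `range (f v)`. -/
theorem Apart.gather_subset [Fintype α] {k : ℕ} {f : Bool → α ↪ Fin k}
    {c : Config A twoNodes (Fin k) k} (h : Apart came S f c) (v : Bool) (a : α)
    (R : Set (Source A.State)) : c.gather id (f v a) v R ⊆ range (f v) := by
  have hk : ∀ b, c.known id (f v b) ⊆ range (f v) := fun b =>
    insert_subset (mem_range_self b) (h.mem v b)
  rintro x (⟨-, hx⟩ | ⟨-, hx⟩ | ⟨j, -, hj, -, hx⟩)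
  · exact hk a hx
  · exact h.boardMem v hx
  · obtain ⟨L, -, hL⟩ := h.crowd v
    obtain ⟨b, rfl⟩ := hL.mem_range j hj
    exact hk b hx

theorem Apart.next [Fintype α] {k : ℕ} {f : Bool → α ↪ Fin k} {c : Config A twoNodes (Fin k) k}
    (hf : ∀ u v a b, f u a = f v b → u = v)
    (hS : ∀ L ∈ S, ∀ a, ¬ L.Leaves came a ∧ L.next came a ∈ S)
    (h : Apart came S f c) (v : Bool) (a : α) : Apart came S f (c.next id (f v a)) := by
  classical
  obtain ⟨L, hLS, hL⟩ := h.crowd v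
  have hst := (hS L hLS a).1
  obtain ⟨w, hw, hc, hl, hs, hb, -⟩ := hL.exists_next_eq (info := id) a hst
  refine ⟨fun u => ?_, fun u b => ?_, fun u => ?_⟩
  · rcases eq_or_ne u v with rfl | huv
    · exact ⟨_, (hS L hLS a).2, hL.next a hst⟩
    · obtain ⟨L', hLS', hL'⟩ := h.crowd u
      refine ⟨L', hLS', fun b => ?_, fun j => ?_, fun b => ?_, ?_⟩
      · rw [hl]; exact hL'.loc b
      · rw [hl]; exact hL'.mem_range j
      · rw [hs, update_of_ne fun he => huv (hf _ _ _ _ he)]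
        exact hL'.state b
      · rw [hb u huv]
        exact hL'.board
  · rcases eq_or_ne (f u b) (f v a) with he | he
    · obtain rfl := hf _ _ _ _ he
      rw [he, Config.next_of_node hw]
      simp only [update_self]
      exact h.gather_subset u a _
    · rw [Config.next_mem_of_ne he]
      exact h.mem u b
  · rw [Config.next_of_node hw]
    rcases eq_or_ne u v with rfl | huv
    · simp only [update_self]
      exact h.gather_subset u a _
    · simp only [update_of_ne huv]
      exact h.boardMem u

/-- In a solution, every crowd can act in such a way that some agent leaves. -/
theorem IsGossipSolution.exists_leaves [Fintype α] [Nonempty α] {d : Duplex} (hA : IsGossipSolution d A)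
    (hne : S.Nonempty) : ∃ L ∈ S, ∃ a, L.Leaves came a ∨ L.next came a ∉ S := by
  -- Otherwise `S` is closed under actions and no agent of a crowd in `S` ever leaves.
  by_contra! hS
  obtain ⟨L, hL⟩ := hne
  -- The algorithm is confronted with twice the number of agents of the crowd.
  let e : Bool × α ≃ Fin (Fintype.card (Bool × α)) := Fintype.equivFin _
  let f : Bool → α ↪ Fin (Fintype.card (Bool × α)) := fun v =>
    ⟨fun a => e (v, a), fun a b h => congrArg Prod.snd (e.injective h)⟩
  have hf : ∀ u v a b, f u a = f v b → u = v := fun u v a b h =>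
    congrArg Prod.fst (e.injective h)
  have hsurj : ∀ j, ∃ v a, f v a = j := fun j =>
    ⟨(e.symm j).1, (e.symm j).2, e.apply_symm_apply j⟩
  have hpos : 0 < Fintype.card (Bool × α) := Fintype.card_pos
  let place : Bool × α → Location twoNodes := fun p =>
    .node p.1 (if came p.2 then some ⟨!p.1, twoNodes_adj _⟩ else none)
  let c₀ : Config A twoNodes (Fin (Fintype.card (Bool × α))) (Fintype.card (Bool × α)) :=
    { loc := fun j => place (e.symm j)
      state := fun j => L.state (e.symm j).2
      mem := fun _ => ∅
      board := fun _ => L.board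
      boardMem := fun _ => ∅ }
  have hloc : ∀ v a, c₀.loc (f v a) = place (v, a) := fun v a =>
    congrArg place (e.symm_apply_apply (v, a))
  have h₀ : Apart came S f c₀ := by
    refine ⟨fun v => ⟨L, hL, fun a => ⟨_, hloc v a, by cases came a <;> rfl⟩, fun j hj => ?_,
      fun a => congrArg (fun p => L.state p.2) (e.symm_apply_apply (v, a)), rfl⟩,
      fun v a => empty_subset _, fun v => empty_subset _⟩
    obtain ⟨u, a, rfl⟩ := hsurj j
    rw [hloc] at hj
    obtain rfl : u = v := hj
    exact mem_range_self a
  -- Any fair schedule would do; this one is round-robin.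
  let sched : ℕ → Fin (Fintype.card (Bool × α)) := fun t => ⟨t % _, Nat.mod_lt t hpos⟩
  let conf : ℕ → Config A twoNodes (Fin (Fintype.card (Bool × α))) (Fintype.card (Bool × α)) :=
    fun t => Nat.rec c₀ (fun t c => c.next id (sched t)) t
  have hconf : ∀ t, Apart came S f (conf t) := by
    intro t
    induction t with
    | zero => exact h₀
    | succ t ih =>
      obtain ⟨v, a, hva⟩ := hsurj (sched t)
      change Apart came S f ((conf t).next id (sched t))
      rw [← hva]
      exact ih.next hf hS v a
  have hlegal : ∀ t, (conf t).Legal d := by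
    intro t
    cases d
    · intro i j dart hi
      obtain ⟨v, a, rfl⟩ := hsurj i
      obtain ⟨L', -, hL'⟩ := (hconf t).crowd v
      obtain ⟨w, hw, -⟩ := hL'.loc a
      rw [hw] at hi
      cases hi
    · trivial
  obtain ⟨T, hT⟩ := hA _ twoNodes _ id
    { conf := conf
      sched := sched
      legal := hlegal
      step := fun _ => rfl
      fair := fun i t => ⟨i + Fintype.card (Bool × α) * t, by nlinarith, 
        Fin.ext ((Nat.add_mul_mod_self_left _ _ _).trans (Nat.mod_eq_of_lt i.2))⟩ }
  obtain ⟨a⟩ := ‹Nonempty α›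
  have hk := hT T le_rfl (f false a) (f true a)
  obtain ⟨b, hb⟩ : f true a ∈ range (f false) :=
    insert_subset (mem_range_self a) ((hconf T).mem false a) hk
  exact absurd (hf _ _ _ _ hb) (by decide)

end Trap

/-! #### A schedule that keeps all agents moving -/

namespace Config

section Run

variable {d : Duplex} {A : Algorithm} {N : Network} {I : Type} {k : ℕ} {info : Fin k → I}

/-- The configuration after the agents in `l` have been scheduled, one after the other. -/
noncomputable def run (info : Fin k → I) (c : Config A N I k) (l : List (Fin k)) :
    Config A N I k :=
  l.foldl (fun c i => c.next info i) c

theorem run_append (c : Config A N I k) (l l' : List (Fin k)) :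
    c.run info (l ++ l') = (c.run info l).run info l' :=
  List.foldl_append

/-- All configurations of a run are legal. -/
def LegalRun (d : Duplex) (info : Fin k → I) : Config A N I k → List (Fin k) → Prop
  | c, [] => c.Legal d
  | c, i :: l => c.Legal d ∧ LegalRun d info (c.next info i) l

theorem LegalRun.append {c : Config A N I k} {l l' : List (Fin k)} (h : c.LegalRun d info l)
    (h' : (c.run info l).LegalRun d info l') : c.LegalRun d info (l ++ l') := by
  induction l generalizing c with
  | nil => exact h'
  | cons i l ih => exact ⟨h.1, ih h.2 h'⟩

theorem LegalRun.legal {c : Config A N I k} {l : List (Fin k)} (h : c.LegalRun d info l) :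
    c.Legal d := by
  cases l with
  | nil => exact h
  | cons i l => exact h.1

theorem LegalRun.legal_run {c : Config A N I k} {l : List (Fin k)}
    (h : c.LegalRun d info l) : (c.run info l).Legal d := by
  induction l generalizing c with
  | nil => exact h
  | cons i l ih => exact ih h.2

/-- The agents in `s` can be made to arrive at nodes. -/
theorem exists_run_arrive {c : Config A N I k} (hc : c.Legal d) (s : Finset (Fin k)) :
    ∃ l, c.LegalRun d info l ∧ ∀ i ∈ s, ∃ v w, (c.run info l).loc i = .node v w := by
  induction s using Finset.induction_on with
  | empty => exact ⟨[], hc, by simp⟩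
  | insert i s _ ih =>
    obtain ⟨l, hl, hs⟩ := ih
    rcases h : (c.run info l).loc i with ⟨v, w⟩ | e
    · exact ⟨l, hl, fun j hj => (Finset.mem_insert.1 hj).elim
        (fun hji => ⟨v, w, hji ▸ h⟩) (hs j)⟩
    · have hloc : (c.run info (l ++ [i])).loc =
          update (c.run info l).loc i (.node e.snd (some ⟨e.fst, e.adj.symm⟩)) := by
        rw [run_append]
        exact congrArg Config.loc (next_of_link h)
      -- An arrival puts no agent on a link, so legality is preserved.
      have hlink : ∀ j e', (c.run info (l ++ [i])).loc j = .link e' →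
          (c.run info l).loc j = .link e' := by
        intro j e' hj
        rcases eq_or_ne j i with rfl | hji
        · simp [hloc] at hj
        · simpa [hloc, hji] using hj
      have hlegal : (c.run info (l ++ [i])).Legal d := by
        cases d
        · exact fun a b e' ha hb => hl.legal_run a b e' (hlink _ _ ha) (hlink _ _ hb)
        · trivial
      refine ⟨l ++ [i], hl.append ⟨hl.legal_run, ?_⟩, fun j hj => ?_⟩
      · rw [run_append] at hlegal
        exact hlegal
      · rcases eq_or_ne j i with rfl | hji
        · exact ⟨_, _, by rw [hloc, update_self]⟩
        · rw [hloc, update_of_ne hji]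
          exact hs j ((Finset.mem_insert.1 hj).resolve_left hji)

/-- The location of agent `i` changes in the course of the run. -/
def Moves (info : Fin k → I) (c : Config A N I k) (l : List (Fin k)) (i : Fin k) : Prop :=
  ∃ l₁ l₂, l₁ <+: l ∧ l₂ <+: l ∧ (c.run info l₁).loc i ≠ (c.run info l₂).loc i

end Run

section TwoNodes

variable {d : Duplex} {A : Algorithm} {I : Type} {k : ℕ} {info : Fin k → I}

/-- All agents on the link are coming from `v`. -/
def Outward (c : Config A twoNodes I k) (v : twoNodes.V) : Prop :=
  ∀ i e, c.loc i = .link e → e.fst = v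

theorem Outward.legal {c : Config A twoNodes I k} {v : twoNodes.V} (h : c.Outward v) :
    c.Legal d := by
  cases d
  · exact fun i j e hi hj => e.fst_ne_snd ((h i e hi).trans (h j e.symm hj).symm)
  · trivial

/-- Induction on the size of the crowd at `v`. Some member can be made to leave; if it is not `i`,
it is never scheduled again during this run, and the remaining crowd is smaller. Nobody arrives
meanwhile. -/
theorem exists_run_leave_of_outward (hA : IsGossipSolution d A) {v : twoNodes.V} {i : Fin k}
    (n : ℕ) {c : Config A twoNodes I k} (hc : c.Outward v) (hi : (c.loc i).IsAt v)
    (hn : {j | (c.loc j).IsAt v}.ncard = n) :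
    ∃ l, c.LegalRun d info l ∧ ∃ e, (c.run info l).loc i = .link e := by
  classical
  induction n using Nat.strong_induction_on generalizing c with
  | _ n ih =>
  let f : {j // (c.loc j).IsAt v} ↪ Fin k := Embedding.subtype _
  have hnode : ∀ a, ∃ w, c.loc (f a) = .node v w := by
    rintro ⟨j, hj⟩
    change ∃ w, c.loc j = .node v w
    rcases h : c.loc j with ⟨u, w⟩ | e
    · rw [h] at hj
      obtain rfl : u = v := hj
      exact ⟨w, rfl⟩
    · rw [h] at hj
      exact hj.elim
  choose w hw using hnode
  let came : {j // (c.loc j).IsAt v} → Bool := fun a => (w a).isSome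
  -- The situations reachable while the whole crowd is still at `v`. Since this set is closed under
  -- actions that stay, `exists_leaves` can only yield a departure.
  let S : Set (Crowd A {j // (c.loc j).IsAt v}) := {L | ∃ l, c.LegalRun d info l ∧
    L.Matches came (c.run info l) f v ∧ (c.run info l).Outward v}
  have hS : S.Nonempty := ⟨⟨fun a => c.state (f a), c.board v⟩, [], hc.legal,
    ⟨fun a => ⟨w a, hw a, rfl⟩, fun j hj => ⟨⟨j, hj⟩, rfl⟩, fun _ => rfl, rfl⟩, hc⟩
  have : Nonempty {j // (c.loc j).IsAt v} := ⟨⟨i, hi⟩⟩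
  obtain ⟨L, ⟨l, hl, hL, ho⟩, a, ha⟩ := hA.exists_leaves (came := came) hS
  have hrun : c.run info (l ++ [f a]) = (c.run info l).next info (f a) := run_append _ _ _
  by_cases hleave : L.Leaves came a
  · obtain ⟨e, he, hloc⟩ := hL.leave (info := info) a hleave
    rw [← hrun] at hloc
    have ho' : (c.run info (l ++ [f a])).Outward v := by
      intro j e' hj
      rcases eq_or_ne j (f a) with rfl | hja
      · rw [hloc, update_self] at hj
        cases hj
        exact he
      · rw [hloc, update_of_ne hja] at hj
        exact ho j e' hj
    have hl' : c.LegalRun d info (l ++ [f a]) := hl.append ⟨hl.legal_run, by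
      rw [← hrun]; exact ho'.legal⟩
    rcases eq_or_ne i (f a) with rfl | hia
    · exact ⟨_, hl', e, by rw [hloc, update_self]⟩
    · have hi' : ((c.run info (l ++ [f a])).loc i).IsAt v := by
        obtain ⟨u, hu, -⟩ := hL.loc ⟨i, hi⟩
        rw [hloc, update_of_ne hia]
        exact hu ▸ rfl
      have hlt : {j | ((c.run info (l ++ [f a])).loc j).IsAt v}.ncard < n := by
        rw [← hn]
        refine Set.ncard_lt_ncard ⟨fun j hj => ?_, fun hsub => ?_⟩ (Set.toFinite _)
        · rcases eq_or_ne j (f a) with rfl | hja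
          · exact a.2
          · have hj' : ((c.run info (l ++ [f a])).loc j).IsAt v := hj
            rw [hloc, update_of_ne hja] at hj'
            obtain ⟨b, rfl⟩ := hL.mem_range j hj'
            exact b.2
        · have hj' : ((c.run info (l ++ [f a])).loc (f a)).IsAt v := hsub a.2
          rw [hloc, update_self] at hj'
          exact hj'
      obtain ⟨l', hl'', e', he'⟩ := ih _ hlt ho' hi' rfl
      exact ⟨_, hl'.append hl'', e', by rw [run_append]; exact he'⟩
  · have hmem : L.next came a ∈ S := by
      obtain ⟨u, -, -, hloc, -⟩ := hL.exists_next_eq (info := info) a hleave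
      have ho' : (c.run info (l ++ [f a])).Outward v := fun j e' hj => ho j e' (by
        rwa [hrun, hloc] at hj)
      exact ⟨l ++ [f a], hl.append ⟨hl.legal_run, by rw [← hrun]; exact ho'.legal⟩,
        by rw [hrun]; exact hL.next a hleave, ho'⟩
    exact (ha.resolve_left hleave hmem).elim

/-- Every agent can be made to move. -/
theorem exists_run_move (hA : IsGossipSolution d A) {c : Config A twoNodes I k}
    (hc : c.Legal d) (i : Fin k) : ∃ l, c.LegalRun d info l ∧ c.Moves info l i := by
  -- With the link empty, `Outward` holds vacuously for the node of `i`.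
  obtain ⟨l, hl, hnode⟩ := exists_run_arrive (info := info) hc Finset.univ
  obtain ⟨v, w, hi⟩ := hnode i (Finset.mem_univ i)
  obtain ⟨l', hl', e, he⟩ := exists_run_leave_of_outward (info := info) hA (v := v) (i := i) _
    (c := c.run info l) (fun j e hj => by
      obtain ⟨u, w', hu⟩ := hnode j (Finset.mem_univ j)
      rw [hu] at hj
      cases hj) (by rw [hi]; rfl) rfl
  refine ⟨l ++ l', hl.append hl', l, l ++ l', List.prefix_append _ _, List.prefix_rfl, ?_⟩
  rw [run_append, hi, he]
  exact fun h => by cases h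

theorem exists_run_move_all (hA : IsGossipSolution d A) {c : Config A twoNodes I k}
    (hc : c.Legal d) : ∃ l, c.LegalRun d info l ∧ ∀ i, c.Moves info l i := by
  suffices h : ∀ s : Finset (Fin k), ∃ l, c.LegalRun d info l ∧ ∀ i ∈ s, c.Moves info l i by
    obtain ⟨l, hl, h⟩ := h Finset.univ
    exact ⟨l, hl, fun i => h i (Finset.mem_univ i)⟩
  intro s
  induction s using Finset.induction_on with
  | empty => exact ⟨[], hc, by simp⟩
  | insert i s _ ih =>
    obtain ⟨l, hl, hs⟩ := ih
    obtain ⟨l', hl', l₁, l₂, h₁, h₂, hne⟩ := exists_run_move (info := info) hA hl.legal_run i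
    refine ⟨l ++ l', hl.append hl', fun j hj => ?_⟩
    rcases Finset.mem_insert.1 hj with rfl | hj
    · refine ⟨l ++ l₁, l ++ l₂, ?_, ?_, ?_⟩
      · exact (List.prefix_append_right_inj l).2 h₁
      · exact (List.prefix_append_right_inj l).2 h₂
      · rwa [run_append, run_append]
    · obtain ⟨m₁, m₂, hm₁, hm₂, hne⟩ := hs j hj
      exact ⟨m₁, m₂, hm₁.trans (List.prefix_append _ _), hm₂.trans (List.prefix_append _ _),
        hne⟩

end TwoNodes

end Config

/-! #### Executions composed of finite runs -/

section Schedule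

variable {d : Duplex} {A : Algorithm} {N : Network} {I : Type} {k : ℕ} {info : Fin k → I}
  (plan : Config A N I k → List (Fin k)) (i₀ : Fin k)

/-- The agents still to be scheduled; when there are none, a new plan is made. -/
def agenda : Config A N I k × List (Fin k) → List (Fin k)
  | (c, []) => plan c
  | (_, i :: l) => i :: l

variable (info) in
/-- The configuration and the remaining agenda at time `t`. -/
noncomputable def follow (c : Config A N I k) : ℕ → Config A N I k × List (Fin k)
  | 0 => (c, [])
  | t + 1 =>
    let l := agenda plan (follow c t)
    ((follow c t).1.next info (l.headD i₀), l.tail)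

variable {plan i₀} {c₀ : Config A N I k}

theorem follow_succ_of_agenda {t : ℕ} {c : Config A N I k} {i : Fin k} {l : List (Fin k)}
    (hc : (follow info plan i₀ c₀ t).1 = c)
    (h : agenda plan (follow info plan i₀ c₀ t) = i :: l) :
    follow info plan i₀ c₀ (t + 1) = (c.next info i, l) := by
  simp [follow, h, hc]

theorem follow_add {t : ℕ} {c : Config A N I k} {l l' : List (Fin k)}
    (h : follow info plan i₀ c₀ t = (c, l ++ l')) :
    follow info plan i₀ c₀ (t + l.length) = (c.run info l, l') := by
  induction l generalizing t c with
  | nil => exact h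
  | cons i l ih =>
    have h' : follow info plan i₀ c₀ (t + 1) = (c.next info i, l ++ l') :=
      follow_succ_of_agenda (by rw [h]) (by rw [h]; rfl)
    rw [List.length_cons, add_comm l.length, ← add_assoc]
    exact ih h'

theorem follow_plan {t : ℕ} {c : Config A N I k} {l : List (Fin k)}
    (h : follow info plan i₀ c₀ t = (c, [])) (hl : l <+: plan c) :
    (follow info plan i₀ c₀ (t + l.length)).1 = c.run info l := by
  obtain ⟨l', hl'⟩ := hl
  cases l with
  | nil => simp [h, Config.run]
  | cons i l =>
    have h' : follow info plan i₀ c₀ (t + 1) = (c.next info i, l ++ l') :=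
      follow_succ_of_agenda (by rw [h]) (by rw [h]; exact hl'.symm)
    rw [List.length_cons, add_comm l.length, ← add_assoc, follow_add h']
    rfl

/-- Working off the agenda left at time `T` empties it, so new plans are made again and again. -/
theorem exists_follow_eq_nil (T : ℕ) :
    ∃ t c, T ≤ t ∧ follow info plan i₀ c₀ t = (c, []) :=
  ⟨_, _, Nat.le_add_right T _, follow_add (c := (follow info plan i₀ c₀ T).1)
    (l := (follow info plan i₀ c₀ T).2) (by rw [List.append_nil])⟩

/-- If from every legal configuration all agents can be made to move, then there is an execution
in which no agent is still forever. -/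
theorem exists_execution_moving (hk : 0 < k) (hc₀ : c₀.Legal d)
    (h : ∀ c : Config A N I k, c.Legal d → ∃ l, c.LegalRun d info l ∧ ∀ i, c.Moves info l i) :
    ∃ E : Execution d A N info, ∀ i T, ∃ t, T ≤ t ∧ (E.conf t).loc i ≠ (E.conf T).loc i := by
  classical
  -- Illegal configurations get a dummy plan, so that `plan` is a total function.
  have h' : ∀ c : Config A N I k, ∃ l, c.Legal d →
      c.LegalRun d info l ∧ ∀ i, c.Moves info l i := fun c => by
    by_cases hc : c.Legal d
    · obtain ⟨l, hl⟩ := h c hc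
      exact ⟨l, fun _ => hl⟩
    · exact ⟨[], fun hc' => (hc hc').elim⟩
  choose plan hplan using h'
  let i₀ : Fin k := ⟨0, hk⟩
  let X := follow info plan i₀ c₀
  have hX : ∀ t, (X t).1.LegalRun d info (X t).2 := by
    intro t
    induction t with
    | zero => exact hc₀
    | succ t ih =>
      -- A plan that moves `i₀` is not empty, so the default value in `headD` is never used.
      have hag : (X t).1.LegalRun d info (agenda plan (X t)) ∧ agenda plan (X t) ≠ [] := by
        rcases hXt : X t with ⟨c, _ | ⟨i, l⟩⟩
        · rw [hXt] at ih
          obtain ⟨hl, hm⟩ := hplan c ih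
          refine ⟨hl, fun hnil => ?_⟩
          obtain ⟨l₁, l₂, h₁, h₂, hne⟩ := hm i₀
          rw [show plan c = [] from hnil, List.prefix_nil] at h₁ h₂
          exact hne (by rw [h₁, h₂])
        · rw [hXt] at ih
          exact ⟨ih, List.cons_ne_nil _ _⟩
      obtain ⟨hl, hne⟩ := hag
      obtain ⟨i, l, hil⟩ := List.exists_cons_of_ne_nil hne
      rw [show X (t + 1) = _ from follow_succ_of_agenda rfl hil]
      rw [hil] at hl
      exact hl.2
  let sched : ℕ → Fin k := fun t => (agenda plan (X t)).headD i₀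
  have hstep : ∀ t, (X (t + 1)).1 = (X t).1.next info (sched t) := fun _ => rfl
  have hmove : ∀ i T, ∃ t, T ≤ t ∧ (X t).1.loc i ≠ (X T).1.loc i := by
    intro i T
    obtain ⟨t, c, ht, htc⟩ := exists_follow_eq_nil (info := info) (plan := plan) (i₀ := i₀)
      (c₀ := c₀) T
    have hc : c.Legal d := by
      have := (hX t).legal
      rwa [show X t = _ from htc] at this
    -- The plan made at time `t` passes through two configurations in which `i` has different
    -- locations; one of them differs from that at `T`.
    obtain ⟨l₁, l₂, h₁, h₂, hne⟩ := (hplan c hc).2 i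
    by_contra! hcon
    have e₁ := hcon (t + l₁.length) (by omega)
    have e₂ := hcon (t + l₂.length) (by omega)
    rw [show (X _).1 = _ from follow_plan htc h₁] at e₁
    rw [show (X _).1 = _ from follow_plan htc h₂] at e₂
    exact hne (e₁.trans e₂.symm)
  -- Fairness comes for free: an agent that is never scheduled again does not move.
  have hfair : ∀ i T, ∃ t, T ≤ t ∧ sched t = i := by
    intro i T
    by_contra! hcon
    obtain ⟨t, ht, hne⟩ := hmove i T
    refine hne ?_
    induction t, ht using Nat.le_induction with
    | base => rfl
    | succ t ht ih =>
      rw [hstep, Config.next_loc_of_ne (hcon t ht).symm]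
      by_contra hne'
      exact hne' (ih hne')
  exact ⟨⟨fun t => (X t).1, sched, fun t => (hX t).legal, hstep, hfair⟩, hmove⟩

end Schedule

/-! ### The quiescence number is 0 -/

theorem IsGossipSolution.not_isQuiescent {d : Duplex} {A : Algorithm} {k n : ℕ}
    (hA : IsGossipSolution d A) (hk : 0 < k) (hn : 0 < n) : ¬ IsQuiescent d A k n := by
  intro hq
  obtain ⟨s⟩ := A.state_nonempty
  obtain ⟨b⟩ := A.board_nonempty
  let c₀ : Config A twoNodes Unit k :=
    { loc := fun _ => .node false none
      state := fun _ => s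
      mem := fun _ => ∅
      board := fun _ => b
      boardMem := fun _ => ∅ }
  have hc₀ : c₀.Legal d := Config.Outward.legal (v := false) fun i e h => by cases h
  obtain ⟨E, hE⟩ := exists_execution_moving (info := fun _ : Fin k => ()) hk hc₀
    fun c hc => Config.exists_run_move_all hA hc
  obtain ⟨T, Q, hQ, hstill⟩ := hq twoNodes Unit _ E
  obtain ⟨i, hi⟩ := Finset.card_pos.1 (hn.trans_le hQ)
  obtain ⟨t, ht, hne⟩ := hE i T
  exact hne (hstill i hi t ht)

end MobileAgents

theorem mainTheorem8 (d : MobileAgents.Duplex) (k : ℕ) (hk : 2 ≤ k) :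
    MobileAgents.IsQuiescenceNumber d k 0 := by
  refine ⟨Or.inr ⟨0, rfl, MobileAgents.explorer, MobileAgents.explorer_isGossipSolution d,
    fun N I info E => ⟨0, ∅, le_rfl, by simp⟩⟩, ?_⟩
  rintro l (rfl | ⟨n, rfl, A, hA, hq⟩)
  · norm_num
  · by_contra hn
    exact hA.not_isQuiescent (by omega) (by omega : 0 < n) hq
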